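/- Consider an $s$-stage partitioned Runge--Kutta (PRK) method with real coefficients $b=(b_i)$, $a=(a_{ij})$, $c=(c_i)$, $B=(B_i)$, $A=(A_{ij})$, $C=(C_i)$. Applied to a Hamiltonian system $\dot q=\partial_p H(q,p,t)$, $\dot p=-\partial_q H(q,p,t)$ with $q,p\in\mathbb R^d$, one step of size $h$ from $(t_0,q_0,p_0)$ is given by $$q_1=q_0+h\sum_{i=1}^s b_i k_i,\quad k_i=\partial_pH(Q_i,P_i,t_0+c_ih),\quad Q_i=q_0+h\sum_{j=1}^s a_{ij}k_j,$$ $$p_1=p_0+h\sum_{i=1}^s B_i \ell_i,\quad \ell_i=-\partial_qH(Q_i,P_i,t_0+C_ih),\quad P_i=p_0+h\sum_{j=1}^s A_{ij}\ell_j,$$ where the stage values $k_i=k_i(h)$, $\ell_i=\ell_i(h)$ solve these (possibly implicit) equations for all small $|h|$ and are continuous at $h=0$. The method has order $r$ for a class of Hamiltonians if, for every $H$ in the class and all initial data $(t_0,q_0,p_0)$ in its domain, such stage values exist, and for every such choice of stage values and every solution $(q(t),p(t))$ of the system near $t_0$ with $(q(t_0),p(t_0))=(q_0,p_0)$, $$q_1-q(t_0+h)=O(h^{r+1}),\qquad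 p_1-p(t_0+h)=O(h^{r+1})\qquad (h\to0).$$ Let $r\le 4$ and suppose that the method has order $r$ for all autonomous separable Hamiltonians $H(q,p)=H_1(q)+H_2(p)$, where $d$ is arbitrary and $H_1,H_2$ are $C^\infty$ functions on open subsets of $\mathbb R^d$ (this property depends only on $b,a,B,A$). If $$c_i=\sum_{j=1}^s A_{ij},\qquad C_i=\sum_{j=1}^s a_{ij}\qquad(i=1,\dots,s),$$ then the method has order $r$ for all non-autonomous separable Hamiltonians $H(q,p,t)=H_1(q,t)+H_2(p,t)$, where $d$ is arbitrary and $H_1,H_2$ are $C^\infty$ functions on open subsets of $\mathbb R^d\times\mathbb R$. -/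

import Mathlib

open scoped Topology ContDiff

/-- Coefficients of an `s`-stage partitioned Runge-Kutta method: `(b, a)` are the weights and stage
coefficients for `q`, `(B, A)` those for `p`; `c` are the time nodes at which `∂H/∂p` is evaluated
and `C` the time nodes at which `∂H/∂q` is evaluated. -/
structure PRK (s : ℕ) where
  b : Fin s → ℝ
  a : Fin s → Fin s → ℝ
  c : Fin s → ℝ
  B : Fin s → ℝ
  A : Fin s → Fin s → ℝ
  C : Fin s → ℝ

/-- The partial gradient `∂H/∂q (q, p, t)`. -/
noncomputable def gradQ {d : ℕ}
    (H : EuclideanSpace ℝ (Fin d) → EuclideanSpace ℝ (Fin d) → ℝ → ℝ)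
    (q p : EuclideanSpace ℝ (Fin d)) (t : ℝ) : EuclideanSpace ℝ (Fin d) :=
  gradient (fun x => H x p t) q

/-- The partial gradient `∂H/∂p (q, p, t)`. -/
noncomputable def gradP {d : ℕ}
    (H : EuclideanSpace ℝ (Fin d) → EuclideanSpace ℝ (Fin d) → ℝ → ℝ)
    (q p : EuclideanSpace ℝ (Fin d)) (t : ℝ) : EuclideanSpace ℝ (Fin d) :=
  gradient (fun y => H q y t) p

/-- `(q, p)` solves `q' = ∂H/∂p`, `p' = -∂H/∂q` on a neighbourhood of `t₀`, with initial values
`q t₀ = q₀` and `p t₀ = p₀`. -/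
def IsHamiltonianSolution {d : ℕ}
    (H : EuclideanSpace ℝ (Fin d) → EuclideanSpace ℝ (Fin d) → ℝ → ℝ)
    (t₀ : ℝ) (q₀ p₀ : EuclideanSpace ℝ (Fin d)) (q p : ℝ → EuclideanSpace ℝ (Fin d)) : Prop :=
  q t₀ = q₀ ∧ p t₀ = p₀ ∧
    ∀ᶠ t in 𝓝 t₀, HasDerivAt q (gradP H (q t) (p t) t) t ∧
      HasDerivAt p (-gradQ H (q t) (p t) t) t

namespace PRK

variable {s d : ℕ}

/-- The internal stage `Q_i = q₀ + h ∑ⱼ a_ij kⱼ`. -/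
noncomputable def stageQ (M : PRK s) (q₀ : EuclideanSpace ℝ (Fin d)) (h : ℝ)
    (k : Fin s → EuclideanSpace ℝ (Fin d)) (i : Fin s) : EuclideanSpace ℝ (Fin d) :=
  q₀ + h • ∑ j, M.a i j • k j

/-- The internal stage `P_i = p₀ + h ∑ⱼ A_ij ℓⱼ`. -/
noncomputable def stageP (M : PRK s) (p₀ : EuclideanSpace ℝ (Fin d)) (h : ℝ)
    (l : Fin s → EuclideanSpace ℝ (Fin d)) (i : Fin s) : EuclideanSpace ℝ (Fin d) :=
  p₀ + h • ∑ j, M.A i j • l j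

/-- The (in general implicit) stage equations of one step of size `h` from `(t₀, q₀, p₀)`. -/
def StageEquations (M : PRK s)
    (H : EuclideanSpace ℝ (Fin d) → EuclideanSpace ℝ (Fin d) → ℝ → ℝ)
    (t₀ : ℝ) (q₀ p₀ : EuclideanSpace ℝ (Fin d)) (h : ℝ)
    (k l : Fin s → EuclideanSpace ℝ (Fin d)) : Prop :=
  ∀ i, k i = gradP H (M.stageQ q₀ h k i) (M.stageP p₀ h l i) (t₀ + M.c i * h) ∧
    l i = -gradQ H (M.stageQ q₀ h k i) (M.stageP p₀ h l i) (t₀ + M.C i * h)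

/-- `h ↦ (k h, l h)` solves the stage equations for all sufficiently small step sizes, and is
continuous at `h = 0` (this selects the branch of solutions of the implicit equations that
starts at the initial data). -/
def IsStageFamily (M : PRK s)
    (H : EuclideanSpace ℝ (Fin d) → EuclideanSpace ℝ (Fin d) → ℝ → ℝ)
    (t₀ : ℝ) (q₀ p₀ : EuclideanSpace ℝ (Fin d))
    (k l : ℝ → Fin s → EuclideanSpace ℝ (Fin d)) : Prop :=
  ContinuousAt k 0 ∧ ContinuousAt l 0 ∧ ∀ᶠ h in 𝓝 0, M.StageEquations H t₀ q₀ p₀ h (k h) (l h)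

/-- The new value `q₀ + h ∑ᵢ bᵢ kᵢ`. -/
noncomputable def stepQ (M : PRK s) (q₀ : EuclideanSpace ℝ (Fin d)) (h : ℝ)
    (k : Fin s → EuclideanSpace ℝ (Fin d)) : EuclideanSpace ℝ (Fin d) :=
  q₀ + h • ∑ i, M.b i • k i

/-- The new value `p₀ + h ∑ᵢ Bᵢ ℓᵢ`. -/
noncomputable def stepP (M : PRK s) (p₀ : EuclideanSpace ℝ (Fin d)) (h : ℝ)
    (l : Fin s → EuclideanSpace ℝ (Fin d)) : EuclideanSpace ℝ (Fin d) :=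
  p₀ + h • ∑ i, M.B i • l i

/-- The method, applied to `H` at `(t₀, q₀, p₀)`, is well defined for small `h` and its local
error is `O(h ^ (r + 1))` as `h → 0`. -/
def HasOrderAt (M : PRK s) (r : ℕ)
    (H : EuclideanSpace ℝ (Fin d) → EuclideanSpace ℝ (Fin d) → ℝ → ℝ)
    (t₀ : ℝ) (q₀ p₀ : EuclideanSpace ℝ (Fin d)) : Prop :=
  (∃ k l, M.IsStageFamily H t₀ q₀ p₀ k l) ∧
  ∀ k l, M.IsStageFamily H t₀ q₀ p₀ k l →
    ∀ q p, IsHamiltonianSolution H t₀ q₀ p₀ q p →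
      ((fun h : ℝ => M.stepQ q₀ h (k h) - q (t₀ + h)) =O[𝓝 0] fun h : ℝ => h ^ (r + 1)) ∧
      ((fun h : ℝ => M.stepP p₀ h (l h) - p (t₀ + h)) =O[𝓝 0] fun h : ℝ => h ^ (r + 1))

/-- Order `r` for all smooth autonomous separable Hamiltonians `H(q, p) = H₁(q) + H₂(p)`, in every
dimension, on arbitrary open domains. The time nodes `c`, `C` play no role here. -/
def HasOrderAutonomous (M : PRK s) (r : ℕ) : Prop :=
  ∀ (d : ℕ) (U V : Set (EuclideanSpace ℝ (Fin d))) (H₁ H₂ : EuclideanSpace ℝ (Fin d) → ℝ),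
    IsOpen U → IsOpen V → ContDiffOn ℝ ∞ H₁ U → ContDiffOn ℝ ∞ H₂ V →
    ∀ (t₀ : ℝ), ∀ q₀ ∈ U, ∀ p₀ ∈ V,
      M.HasOrderAt r (fun q p _ => H₁ q + H₂ p) t₀ q₀ p₀

/-- Order `r` for all smooth non-autonomous separable Hamiltonians
`H(q, p, t) = H₁(q, t) + H₂(p, t)`, in every dimension, on arbitrary open domains. -/
def HasOrderNonautonomous (M : PRK s) (r : ℕ) : Prop :=
  ∀ (d : ℕ) (U V : Set (EuclideanSpace ℝ (Fin d) × ℝ))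
    (H₁ H₂ : EuclideanSpace ℝ (Fin d) → ℝ → ℝ),
    IsOpen U → IsOpen V →
    ContDiffOn ℝ ∞ (fun x : EuclideanSpace ℝ (Fin d) × ℝ => H₁ x.1 x.2) U →
    ContDiffOn ℝ ∞ (fun x : EuclideanSpace ℝ (Fin d) × ℝ => H₂ x.1 x.2) V →
    ∀ (t₀ : ℝ) (q₀ p₀ : EuclideanSpace ℝ (Fin d)), (q₀, t₀) ∈ U → (p₀, t₀) ∈ V →
      M.HasOrderAt r (fun q p t => H₁ q t + H₂ p t) t₀ q₀ p₀

end PRK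

/-! Time becomes a pair of extra coordinates: with positions `(q, σ, ξ)` and momenta `(p, π, τ)`,
the autonomous Hamiltonian `(H₁(q, σ) - ξ) + (H₂(p, τ) + π)` is still separable and its equations
force `σ' = τ' = 1`. So `σ` and `τ` are both clocks, `H₁` reading the one among the positions and
`H₂` the one among the momenta. A Runge–Kutta step integrates `σ' = 1` with stages `t₀ + h ∑ⱼ aᵢⱼ
= t₀ + Cᵢ h` and `τ' = 1` with stages `t₀ + h ∑ⱼ Aᵢⱼ = t₀ + cᵢ h`. Hence the method applied to the
extended system carries along the method applied to the original one, and the local error of the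
latter is a projection of the local error of the former. -/

open Filter
open scoped InnerProductSpace

section Calculus

variable {E : Type*} [NormedAddCommGroup E]

theorem exists_eventually_hasDerivAt_of_eventually_continuousAt [NormedSpace ℝ E] [CompleteSpace E]
    {f : ℝ → E} {t₀ : ℝ} (hf : ∀ᶠ t in 𝓝 t₀, ContinuousAt f t) :
    ∃ g : ℝ → E, g t₀ = 0 ∧ ∀ᶠ t in 𝓝 t₀, HasDerivAt g (f t) t := by
  obtain ⟨ε, hε, hball⟩ := Metric.eventually_nhds_iff_ball.1 hf
  have hcont : ContinuousOn f (Metric.ball t₀ ε) := fun t ht => (hball t ht).continuousWithinAt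
  refine ⟨fun t => ∫ u in t₀..t, f u, intervalIntegral.integral_same, ?_⟩
  filter_upwards [Metric.ball_mem_nhds t₀ hε] with t ht
  have hsub : Set.uIcc t₀ t ⊆ Metric.ball t₀ ε :=
    (convex_ball t₀ ε).ordConnected.uIcc_subset (Metric.mem_ball_self hε) ht
  exact intervalIntegral.integral_hasDerivAt_right (hcont.mono hsub).intervalIntegrable
    (hcont.stronglyMeasurableAtFilter Metric.isOpen_ball t ht) (hball t ht)

/-- The partial derivative `∂H/∂t` of a function `H` of space-time points `(x, t)`. -/
noncomputable def timeDeriv [NormedSpace ℝ E] (H : E × ℝ → ℝ) (z : E × ℝ) : ℝ :=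
  fderiv ℝ H z (0, 1)

/-- The partial gradient `∂H/∂x` of a function `H` of space-time points `(x, t)`. -/
noncomputable def spaceGradient [InnerProductSpace ℝ E] [CompleteSpace E]
    (H : E × ℝ → ℝ) (z : E × ℝ) : E :=
  gradient (fun x => H (x, z.2)) z.1

theorem continuousAt_timeDeriv [NormedSpace ℝ E] {H : E × ℝ → ℝ} {z : E × ℝ}
    (hH : ContDiffAt ℝ 1 H z) : ContinuousAt (timeDeriv H) z :=
  (hH.continuousAt_fderiv one_ne_zero).clm_apply continuousAt_const

theorem fderiv_spaceTime_apply [InnerProductSpace ℝ E] [CompleteSpace E] {H : E × ℝ → ℝ}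
    {z : E × ℝ} (hH : DifferentiableAt ℝ H z) (v : E) (a : ℝ) :
    fderiv ℝ H z (v, a) = ⟪spaceGradient H z, v⟫_ℝ + timeDeriv H z * a := by
  have hspace : ⟪spaceGradient H z, v⟫_ℝ = fderiv ℝ H z (v, 0) := by
    have h : HasFDerivAt (fun x => H (x, z.2)) _ z.1 :=
      hH.hasFDerivAt.comp z.1 (hasFDerivAt_prodMk_left z.1 z.2)
    rw [spaceGradient, inner_gradient_left, h.fderiv]
    rfl
  have hsplit : (v, a) = (v, 0) + a • ((0, 1) : E × ℝ) := by simp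
  rw [hsplit, map_add, map_smul, hspace, timeDeriv, smul_eq_mul, mul_comm]

end Calculus

section SplitCoords

variable {d : ℕ}

/-- The identification of `ℝ^(d+2)` with `ℝ^d × ℝ × ℝ`, splitting off the last two coordinates. -/
noncomputable def splitCoords (d : ℕ) :
    EuclideanSpace ℝ (Fin (d + 2)) ≃L[ℝ] EuclideanSpace ℝ (Fin d) × ℝ × ℝ :=
  EuclideanSpace.finAddEquivProd.trans <| (ContinuousLinearEquiv.refl ℝ _).prodCongr <|
    (EuclideanSpace.equiv (Fin 2) ℝ).trans (ContinuousLinearEquiv.finTwoArrow ℝ ℝ)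

theorem inner_eq_splitCoords (x y : EuclideanSpace ℝ (Fin (d + 2))) :
    ⟪x, y⟫_ℝ = ⟪(splitCoords d x).1, (splitCoords d y).1⟫_ℝ
      + (splitCoords d x).2.1 * (splitCoords d y).2.1
      + (splitCoords d x).2.2 * (splitCoords d y).2.2 := by
  have hinner {n : ℕ} (u v : EuclideanSpace ℝ (Fin n)) : ⟪u, v⟫_ℝ = ∑ i, u i * v i := by
    simp [PiLp.inner_apply, mul_comm]
  rw [hinner, hinner, Fin.sum_univ_add, Fin.sum_univ_two, add_assoc]
  rfl

theorem gradient_comp_splitCoords {f : EuclideanSpace ℝ (Fin d) × ℝ × ℝ → ℝ}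
    {f' : EuclideanSpace ℝ (Fin d) × ℝ × ℝ →L[ℝ] ℝ} {x : EuclideanSpace ℝ (Fin (d + 2))}
    (hf : HasFDerivAt f f' (splitCoords d x)) {g : EuclideanSpace ℝ (Fin d)} {α β : ℝ}
    (hf' : ∀ v a b, f' (v, a, b) = ⟪g, v⟫_ℝ + α * a + β * b) :
    gradient (fun y => f (splitCoords d y)) x = (splitCoords d).symm (g, α, β) := by
  refine ext_inner_right ℝ fun y => ?_
  have h : HasFDerivAt (fun y => f (splitCoords d y)) _ x :=
    hf.comp x (splitCoords d).hasFDerivAt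
  rw [inner_gradient_left, h.fderiv, inner_eq_splitCoords,
    ContinuousLinearEquiv.apply_symm_apply]
  exact hf' _ _ _

/-- The map `(q, σ, ξ) ↦ (q, σ)`: in an extended position, the first additional coordinate is the
clock. -/
noncomputable def positionTime (d : ℕ) :
    EuclideanSpace ℝ (Fin (d + 2)) →L[ℝ] EuclideanSpace ℝ (Fin d) × ℝ :=
  ((ContinuousLinearMap.id ℝ _).prodMap (.fst ℝ ℝ ℝ)) ∘L (splitCoords d : _ →L[ℝ] _)

/-- The map `(p, π, τ) ↦ (p, τ)`: in an extended momentum, the second additional coordinate is the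
clock. -/
noncomputable def momentumTime (d : ℕ) :
    EuclideanSpace ℝ (Fin (d + 2)) →L[ℝ] EuclideanSpace ℝ (Fin d) × ℝ :=
  ((ContinuousLinearMap.id ℝ _).prodMap (.snd ℝ ℝ ℝ)) ∘L (splitCoords d : _ →L[ℝ] _)

theorem positionTime_apply (x : EuclideanSpace ℝ (Fin (d + 2))) :
    positionTime d x = ((splitCoords d x).1, (splitCoords d x).2.1) :=
  rfl

theorem momentumTime_apply (x : EuclideanSpace ℝ (Fin (d + 2))) :
    momentumTime d x = ((splitCoords d x).1, (splitCoords d x).2.2) :=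
  rfl

theorem positionTime_symm (q : EuclideanSpace ℝ (Fin d)) (σ ξ : ℝ) :
    positionTime d ((splitCoords d).symm (q, σ, ξ)) = (q, σ) := by
  rw [positionTime_apply, ContinuousLinearEquiv.apply_symm_apply]

theorem momentumTime_symm (p : EuclideanSpace ℝ (Fin d)) (π τ : ℝ) :
    momentumTime d ((splitCoords d).symm (p, π, τ)) = (p, τ) := by
  rw [momentumTime_apply, ContinuousLinearEquiv.apply_symm_apply]

end SplitCoords

section ExtendedHamiltonian

variable {d : ℕ} {H₁ H₂ : EuclideanSpace ℝ (Fin d) × ℝ → ℝ}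

/-- The separable Hamiltonian `H₁(q, t) + H₂(p, t)` built from functions of space-time points. -/
def separableHamiltonian (H₁ H₂ : EuclideanSpace ℝ (Fin d) × ℝ → ℝ)
    (q p : EuclideanSpace ℝ (Fin d)) (t : ℝ) : ℝ :=
  H₁ (q, t) + H₂ (p, t)

theorem gradQ_separableHamiltonian (q p : EuclideanSpace ℝ (Fin d)) (t : ℝ) :
    gradQ (separableHamiltonian H₁ H₂) q p t = spaceGradient H₁ (q, t) := by
  simp [gradQ, spaceGradient, separableHamiltonian, gradient]

theorem gradP_separableHamiltonian (q p : EuclideanSpace ℝ (Fin d)) (t : ℝ) :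
    gradP (separableHamiltonian H₁ H₂) q p t = spaceGradient H₂ (p, t) := by
  simp [gradP, spaceGradient, separableHamiltonian, gradient]

/-- The autonomous function `H₁(q, σ) - ξ` of the extended position `(q, σ, ξ)`. -/
noncomputable def extendedPotential (H₁ : EuclideanSpace ℝ (Fin d) × ℝ → ℝ)
    (x : EuclideanSpace ℝ (Fin (d + 2))) : ℝ :=
  H₁ (positionTime d x) - (splitCoords d x).2.2

/-- The autonomous function `H₂(p, τ) + π` of the extended momentum `(p, π, τ)`. -/
noncomputable def extendedKinetic (H₂ : EuclideanSpace ℝ (Fin d) × ℝ → ℝ)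
    (y : EuclideanSpace ℝ (Fin (d + 2))) : ℝ :=
  H₂ (momentumTime d y) + (splitCoords d y).2.1

/-- The autonomous separable Hamiltonian `(H₁(q, σ) - ξ) + (H₂(p, τ) + π)`, whose flow drives both
clocks `σ` and `τ` at unit speed. -/
noncomputable def extendedHamiltonian (H₁ H₂ : EuclideanSpace ℝ (Fin d) × ℝ → ℝ)
    (x y : EuclideanSpace ℝ (Fin (d + 2))) (_t : ℝ) : ℝ :=
  extendedPotential H₁ x + extendedKinetic H₂ y

theorem contDiffOn_extendedPotential {n : WithTop ℕ∞} {U : Set (EuclideanSpace ℝ (Fin d) × ℝ)}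
    (hH₁ : ContDiffOn ℝ n H₁ U) :
    ContDiffOn ℝ n (extendedPotential H₁) (positionTime d ⁻¹' U) :=
  (hH₁.comp (positionTime d).contDiff.contDiffOn fun _ hx => hx).sub
    (by fun_prop)

theorem contDiffOn_extendedKinetic {n : WithTop ℕ∞} {V : Set (EuclideanSpace ℝ (Fin d) × ℝ)}
    (hH₂ : ContDiffOn ℝ n H₂ V) :
    ContDiffOn ℝ n (extendedKinetic H₂) (momentumTime d ⁻¹' V) :=
  (hH₂.comp (momentumTime d).contDiff.contDiffOn fun _ hy => hy).add
    (by fun_prop)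

theorem gradient_extendedPotential {x : EuclideanSpace ℝ (Fin (d + 2))}
    (hH₁ : DifferentiableAt ℝ H₁ (positionTime d x)) :
    gradient (extendedPotential H₁) x = (splitCoords d).symm
      (spaceGradient H₁ (positionTime d x), timeDeriv H₁ (positionTime d x), -1) := by
  have h := (hH₁.hasFDerivAt.comp (splitCoords d x)
    ((ContinuousLinearMap.id ℝ _).prodMap (.fst ℝ ℝ ℝ)).hasFDerivAt).sub
    (hasFDerivAt_snd.comp (splitCoords d x) hasFDerivAt_snd)
  refine gradient_comp_splitCoords h fun v a b => ?_
  simp [fderiv_spaceTime_apply hH₁, sub_eq_add_neg]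

theorem gradient_extendedKinetic {y : EuclideanSpace ℝ (Fin (d + 2))}
    (hH₂ : DifferentiableAt ℝ H₂ (momentumTime d y)) :
    gradient (extendedKinetic H₂) y = (splitCoords d).symm
      (spaceGradient H₂ (momentumTime d y), 1, timeDeriv H₂ (momentumTime d y)) := by
  have h := (hH₂.hasFDerivAt.comp (splitCoords d y)
    ((ContinuousLinearMap.id ℝ _).prodMap (.snd ℝ ℝ ℝ)).hasFDerivAt).add
    (hasFDerivAt_fst.comp (splitCoords d y) hasFDerivAt_snd)
  refine gradient_comp_splitCoords h fun v a b => ?_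
  simp [fderiv_spaceTime_apply hH₂, add_right_comm]

theorem neg_gradQ_extendedHamiltonian {x : EuclideanSpace ℝ (Fin (d + 2))}
    (hH₁ : DifferentiableAt ℝ H₁ (positionTime d x)) (y : EuclideanSpace ℝ (Fin (d + 2))) (t : ℝ) :
    -gradQ (extendedHamiltonian H₁ H₂) x y t = (splitCoords d).symm
      (-spaceGradient H₁ (positionTime d x), -timeDeriv H₁ (positionTime d x), 1) := by
  have h : gradQ (extendedHamiltonian H₁ H₂) x y t = gradient (extendedPotential H₁) x := by
    simp [gradQ, extendedHamiltonian, gradient]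
  rw [h, gradient_extendedPotential hH₁, ← map_neg, Prod.neg_mk, Prod.neg_mk, neg_neg]

theorem gradP_extendedHamiltonian {y : EuclideanSpace ℝ (Fin (d + 2))}
    (hH₂ : DifferentiableAt ℝ H₂ (momentumTime d y)) (x : EuclideanSpace ℝ (Fin (d + 2))) (t : ℝ) :
    gradP (extendedHamiltonian H₁ H₂) x y t = (splitCoords d).symm
      (spaceGradient H₂ (momentumTime d y), 1, timeDeriv H₂ (momentumTime d y)) := by
  rw [← gradient_extendedKinetic hH₂]
  simp [gradP, extendedHamiltonian, gradient]

end ExtendedHamiltonian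

/-- The update `x + h ∑ⱼ wⱼ kⱼ` with weights `w` and slopes `k`; the stages and the new values of a
partitioned Runge–Kutta step all have this form. -/
def weightedStep {ι E : Type*} [Fintype ι] [AddCommGroup E] [Module ℝ E]
    (w : ι → ℝ) (x : E) (h : ℝ) (k : ι → E) : E :=
  x + h • ∑ j, w j • k j

section WeightedStep

variable {ι E F : Type*} [Fintype ι]

theorem map_weightedStep {𝓕 : Type*} [AddCommGroup E] [Module ℝ E] [AddCommGroup F] [Module ℝ F]
    [FunLike 𝓕 E F] [LinearMapClass 𝓕 ℝ E F] (f : 𝓕) (w : ι → ℝ) (x : E) (h : ℝ) (k : ι → E) :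
    f (weightedStep w x h k) = weightedStep w (f x) h fun j => f (k j) := by
  simp only [weightedStep, map_add, map_smul, map_sum]

theorem weightedStep_prod_one [AddCommGroup E] [Module ℝ E] (w : ι → ℝ) (x : E) (t h : ℝ)
    (k : ι → E) :
    weightedStep w (x, t) h (fun j => (k j, (1 : ℝ))) =
      (weightedStep w x h k, t + (∑ j, w j) * h) := by
  simp [weightedStep, Prod.ext_iff, Prod.fst_sum, Prod.snd_sum, mul_comm]

theorem continuousAt_weightedStep [AddCommGroup E] [Module ℝ E] [TopologicalSpace E]
    [ContinuousAdd E] [ContinuousSMul ℝ E] (w : ι → ℝ) (x : E) {k : ℝ → ι → E} {h₀ : ℝ}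
    (hk : ContinuousAt k h₀) : ContinuousAt (fun h => weightedStep w x h (k h)) h₀ := by
  have hk' (j : ι) : ContinuousAt (fun h => k h j) h₀ := continuousAt_pi.1 hk j
  unfold weightedStep
  fun_prop

theorem tendsto_weightedStep [AddCommGroup E] [Module ℝ E] [TopologicalSpace E]
    [ContinuousAdd E] [ContinuousSMul ℝ E] (w : ι → ℝ) (x : E) {k : ℝ → ι → E}
    (hk : ContinuousAt k 0) : Tendsto (fun h => weightedStep w x h (k h)) (𝓝 0) (𝓝 x) := by
  have h₀ : weightedStep w x 0 (k 0) = x := by rw [weightedStep, zero_smul, add_zero]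
  simpa only [h₀] using (continuousAt_weightedStep w x hk).tendsto

end WeightedStep

namespace PRK

variable {s d : ℕ} {M : PRK s} {H₁ H₂ : EuclideanSpace ℝ (Fin d) × ℝ → ℝ} {t₀ : ℝ}
  {q₀ p₀ : EuclideanSpace ℝ (Fin d)} {x₀ y₀ : EuclideanSpace ℝ (Fin (d + 2))}

theorem stageQ_eq_weightedStep (M : PRK s) (q₀ : EuclideanSpace ℝ (Fin d)) (h : ℝ)
    (k : Fin s → EuclideanSpace ℝ (Fin d)) (i : Fin s) :
    M.stageQ q₀ h k i = weightedStep (M.a i) q₀ h k :=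
  rfl

theorem stageP_eq_weightedStep (M : PRK s) (p₀ : EuclideanSpace ℝ (Fin d)) (h : ℝ)
    (l : Fin s → EuclideanSpace ℝ (Fin d)) (i : Fin s) :
    M.stageP p₀ h l i = weightedStep (M.A i) p₀ h l :=
  rfl

theorem stepQ_eq_weightedStep (M : PRK s) (q₀ : EuclideanSpace ℝ (Fin d)) (h : ℝ)
    (k : Fin s → EuclideanSpace ℝ (Fin d)) : M.stepQ q₀ h k = weightedStep M.b q₀ h k :=
  rfl

theorem stepP_eq_weightedStep (M : PRK s) (p₀ : EuclideanSpace ℝ (Fin d)) (h : ℝ)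
    (l : Fin s → EuclideanSpace ℝ (Fin d)) : M.stepP p₀ h l = weightedStep M.B p₀ h l :=
  rfl

/-- The space-time point `(Qᵢ, t₀ + Cᵢ h)` at which the `i`-th stage evaluates `∂H/∂q` when `H` is
separable. -/
noncomputable def nodeQ (M : PRK s) (t₀ : ℝ) (q₀ : EuclideanSpace ℝ (Fin d)) (h : ℝ)
    (k : Fin s → EuclideanSpace ℝ (Fin d)) (i : Fin s) : EuclideanSpace ℝ (Fin d) × ℝ :=
  (M.stageQ q₀ h k i, t₀ + M.C i * h)

/-- The space-time point `(Pᵢ, t₀ + cᵢ h)` at which the `i`-th stage evaluates `∂H/∂p` when `H` is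
separable. -/
noncomputable def nodeP (M : PRK s) (t₀ : ℝ) (p₀ : EuclideanSpace ℝ (Fin d)) (h : ℝ)
    (l : Fin s → EuclideanSpace ℝ (Fin d)) (i : Fin s) : EuclideanSpace ℝ (Fin d) × ℝ :=
  (M.stageP p₀ h l i, t₀ + M.c i * h)

theorem nodeQ_zero (k : Fin s → EuclideanSpace ℝ (Fin d)) (i : Fin s) :
    M.nodeQ t₀ q₀ 0 k i = (q₀, t₀) := by
  simp [nodeQ, stageQ]

theorem nodeP_zero (l : Fin s → EuclideanSpace ℝ (Fin d)) (i : Fin s) :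
    M.nodeP t₀ p₀ 0 l i = (p₀, t₀) := by
  simp [nodeP, stageP]

theorem continuousAt_nodeQ {k : ℝ → Fin s → EuclideanSpace ℝ (Fin d)} {h₀ : ℝ}
    (hk : ContinuousAt k h₀) (i : Fin s) : ContinuousAt (fun h => M.nodeQ t₀ q₀ h (k h) i) h₀ :=
  (continuousAt_weightedStep (M.a i) q₀ hk).prodMk (by fun_prop)

theorem continuousAt_nodeP {l : ℝ → Fin s → EuclideanSpace ℝ (Fin d)} {h₀ : ℝ}
    (hl : ContinuousAt l h₀) (i : Fin s) : ContinuousAt (fun h => M.nodeP t₀ p₀ h (l h) i) h₀ :=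
  (continuousAt_weightedStep (M.A i) p₀ hl).prodMk (by fun_prop)

theorem stageEquations_separableHamiltonian_iff {h : ℝ}
    {k l : Fin s → EuclideanSpace ℝ (Fin d)} :
    M.StageEquations (separableHamiltonian H₁ H₂) t₀ q₀ p₀ h k l ↔
      ∀ i, k i = spaceGradient H₂ (M.nodeP t₀ p₀ h l i) ∧
        l i = -spaceGradient H₁ (M.nodeQ t₀ q₀ h k i) := by
  simp only [StageEquations, gradP_separableHamiltonian, gradQ_separableHamiltonian, nodeP, nodeQ]

theorem positionTime_stageQ (hC : ∀ i, M.C i = ∑ j, M.a i j)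
    (hx₀ : positionTime d x₀ = (q₀, t₀)) {h : ℝ} {k : Fin s → EuclideanSpace ℝ (Fin d)}
    {K : Fin s → EuclideanSpace ℝ (Fin (d + 2))} (hK : ∀ j, positionTime d (K j) = (k j, 1))
    (i : Fin s) : positionTime d (M.stageQ x₀ h K i) = M.nodeQ t₀ q₀ h k i := by
  rw [stageQ_eq_weightedStep, map_weightedStep, hx₀, funext hK, weightedStep_prod_one, ← hC]
  rfl

theorem momentumTime_stageP (hc : ∀ i, M.c i = ∑ j, M.A i j)
    (hy₀ : momentumTime d y₀ = (p₀, t₀)) {h : ℝ} {l : Fin s → EuclideanSpace ℝ (Fin d)}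
    {L : Fin s → EuclideanSpace ℝ (Fin (d + 2))} (hL : ∀ j, momentumTime d (L j) = (l j, 1))
    (i : Fin s) : momentumTime d (M.stageP y₀ h L i) = M.nodeP t₀ p₀ h l i := by
  rw [stageP_eq_weightedStep, map_weightedStep, hy₀, funext hL, weightedStep_prod_one, ← hc]
  rfl

theorem StageEquations.restrict (hc : ∀ i, M.c i = ∑ j, M.A i j)
    (hC : ∀ i, M.C i = ∑ j, M.a i j) (hx₀ : positionTime d x₀ = (q₀, t₀))
    (hy₀ : momentumTime d y₀ = (p₀, t₀)) {t h : ℝ} {K L : Fin s → EuclideanSpace ℝ (Fin (d + 2))}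
    (hKL : M.StageEquations (extendedHamiltonian H₁ H₂) t x₀ y₀ h K L)
    (hH₁ : ∀ i, DifferentiableAt ℝ H₁ (positionTime d (M.stageQ x₀ h K i)))
    (hH₂ : ∀ i, DifferentiableAt ℝ H₂ (momentumTime d (M.stageP y₀ h L i))) :
    M.StageEquations (separableHamiltonian H₁ H₂) t₀ q₀ p₀ h
      (fun i => (splitCoords d (K i)).1) (fun i => (splitCoords d (L i)).1) := by
  have hK (i : Fin s) : splitCoords d (K i) =
      (spaceGradient H₂ (momentumTime d (M.stageP y₀ h L i)), 1,
        timeDeriv H₂ (momentumTime d (M.stageP y₀ h L i))) := by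
    rw [(hKL i).1, gradP_extendedHamiltonian (hH₂ i), ContinuousLinearEquiv.apply_symm_apply]
  have hL (i : Fin s) : splitCoords d (L i) =
      (-spaceGradient H₁ (positionTime d (M.stageQ x₀ h K i)),
        -timeDeriv H₁ (positionTime d (M.stageQ x₀ h K i)), 1) := by
    rw [(hKL i).2, neg_gradQ_extendedHamiltonian (hH₁ i), ContinuousLinearEquiv.apply_symm_apply]
  refine stageEquations_separableHamiltonian_iff.2 fun i => ?_
  rw [← positionTime_stageQ hC hx₀ (fun j => by rw [positionTime_apply, hK]) i,
    ← momentumTime_stageP hc hy₀ (fun j => by rw [momentumTime_apply, hL]) i]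
  exact ⟨congrArg Prod.fst (hK i), congrArg Prod.fst (hL i)⟩

theorem StageEquations.extend (hc : ∀ i, M.c i = ∑ j, M.A i j)
    (hC : ∀ i, M.C i = ∑ j, M.a i j) (hx₀ : positionTime d x₀ = (q₀, t₀))
    (hy₀ : momentumTime d y₀ = (p₀, t₀)) {h : ℝ} {k l : Fin s → EuclideanSpace ℝ (Fin d)}
    (hkl : M.StageEquations (separableHamiltonian H₁ H₂) t₀ q₀ p₀ h k l)
    (hH₁ : ∀ i, DifferentiableAt ℝ H₁ (M.nodeQ t₀ q₀ h k i))
    (hH₂ : ∀ i, DifferentiableAt ℝ H₂ (M.nodeP t₀ p₀ h l i)) (t : ℝ) :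
    M.StageEquations (extendedHamiltonian H₁ H₂) t x₀ y₀ h
      (fun i => (splitCoords d).symm (k i, 1, timeDeriv H₂ (M.nodeP t₀ p₀ h l i)))
      (fun i => (splitCoords d).symm (l i, -timeDeriv H₁ (M.nodeQ t₀ q₀ h k i), 1)) := by
  intro i
  obtain ⟨hk, hl⟩ := stageEquations_separableHamiltonian_iff.1 hkl i
  have hQ := positionTime_stageQ hC hx₀ (h := h)
    (fun j => positionTime_symm (k j) 1 (timeDeriv H₂ (M.nodeP t₀ p₀ h l j))) i
  have hP := momentumTime_stageP hc hy₀ (h := h)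
    (fun j => momentumTime_symm (l j) (-timeDeriv H₁ (M.nodeQ t₀ q₀ h k j)) 1) i
  constructor
  · rw [gradP_extendedHamiltonian (hP ▸ hH₂ i), hP, ← hk]
  · rw [neg_gradQ_extendedHamiltonian (hQ ▸ hH₁ i), hQ, ← hl]

theorem IsStageFamily.restrict (hc : ∀ i, M.c i = ∑ j, M.A i j)
    (hC : ∀ i, M.C i = ∑ j, M.a i j) (hx₀ : positionTime d x₀ = (q₀, t₀))
    (hy₀ : momentumTime d y₀ = (p₀, t₀)) (hH₁ : ContDiffAt ℝ 1 H₁ (q₀, t₀))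
    (hH₂ : ContDiffAt ℝ 1 H₂ (p₀, t₀)) {t : ℝ} {K L : ℝ → Fin s → EuclideanSpace ℝ (Fin (d + 2))}
    (hKL : M.IsStageFamily (extendedHamiltonian H₁ H₂) t x₀ y₀ K L) :
    M.IsStageFamily (separableHamiltonian H₁ H₂) t₀ q₀ p₀
      (fun h i => (splitCoords d (K h i)).1) (fun h i => (splitCoords d (L h i)).1) := by
  obtain ⟨hK, hL, hE⟩ := hKL
  rw [← hx₀] at hH₁
  rw [← hy₀] at hH₂
  have hdiffQ : ∀ᶠ h in 𝓝 0, ∀ i, ContDiffAt ℝ 1 H₁ (positionTime d (M.stageQ x₀ h (K h) i)) :=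
    eventually_all.2 fun i => (((positionTime d).continuous.tendsto x₀).comp
      (tendsto_weightedStep (M.a i) x₀ hK)).eventually (hH₁.eventually (by simp))
  have hdiffP : ∀ᶠ h in 𝓝 0, ∀ i, ContDiffAt ℝ 1 H₂ (momentumTime d (M.stageP y₀ h (L h) i)) :=
    eventually_all.2 fun i => (((momentumTime d).continuous.tendsto y₀).comp
      (tendsto_weightedStep (M.A i) y₀ hL)).eventually (hH₂.eventually (by simp))
  have hsplit : Continuous fun x => (splitCoords d x).1 :=
    continuous_fst.comp (splitCoords d).continuous
  refine ⟨continuousAt_pi.2 fun i => hsplit.continuousAt.comp (continuousAt_pi.1 hK i),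
    continuousAt_pi.2 fun i => hsplit.continuousAt.comp (continuousAt_pi.1 hL i), ?_⟩
  filter_upwards [hE, hdiffQ, hdiffP] with h hE hdiffQ hdiffP
  exact hE.restrict hc hC hx₀ hy₀ (fun i => (hdiffQ i).differentiableAt one_ne_zero)
    fun i => (hdiffP i).differentiableAt one_ne_zero

theorem IsStageFamily.extend (hc : ∀ i, M.c i = ∑ j, M.A i j)
    (hC : ∀ i, M.C i = ∑ j, M.a i j) (hx₀ : positionTime d x₀ = (q₀, t₀))
    (hy₀ : momentumTime d y₀ = (p₀, t₀)) (hH₁ : ContDiffAt ℝ 1 H₁ (q₀, t₀))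
    (hH₂ : ContDiffAt ℝ 1 H₂ (p₀, t₀)) {k l : ℝ → Fin s → EuclideanSpace ℝ (Fin d)}
    (hkl : M.IsStageFamily (separableHamiltonian H₁ H₂) t₀ q₀ p₀ k l) (t : ℝ) :
    M.IsStageFamily (extendedHamiltonian H₁ H₂) t x₀ y₀
      (fun h i => (splitCoords d).symm (k h i, 1, timeDeriv H₂ (M.nodeP t₀ p₀ h (l h) i)))
      (fun h i => (splitCoords d).symm (l h i, -timeDeriv H₁ (M.nodeQ t₀ q₀ h (k h) i), 1)) := by
  obtain ⟨hk, hl, hE⟩ := hkl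
  have hderivQ (i : Fin s) : ContinuousAt (fun h => timeDeriv H₁ (M.nodeQ t₀ q₀ h (k h) i)) 0 :=
    (continuousAt_timeDeriv hH₁).comp_of_eq (continuousAt_nodeQ hk i) (nodeQ_zero (k 0) i)
  have hderivP (i : Fin s) : ContinuousAt (fun h => timeDeriv H₂ (M.nodeP t₀ p₀ h (l h) i)) 0 :=
    (continuousAt_timeDeriv hH₂).comp_of_eq (continuousAt_nodeP hl i) (nodeP_zero (l 0) i)
  have hdiffQ : ∀ᶠ h in 𝓝 0, ∀ i, ContDiffAt ℝ 1 H₁ (M.nodeQ t₀ q₀ h (k h) i) :=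
    eventually_all.2 fun i => (continuousAt_nodeQ hk i).eventually <| by
      simpa only [nodeQ_zero] using hH₁.eventually (by simp)
  have hdiffP : ∀ᶠ h in 𝓝 0, ∀ i, ContDiffAt ℝ 1 H₂ (M.nodeP t₀ p₀ h (l h) i) :=
    eventually_all.2 fun i => (continuousAt_nodeP hl i).eventually <| by
      simpa only [nodeP_zero] using hH₂.eventually (by simp)
  have hsymm := (splitCoords d).symm.continuous
  refine ⟨continuousAt_pi.2 fun i => hsymm.continuousAt.comp <|
      (continuousAt_pi.1 hk i).prodMk (continuousAt_const.prodMk (hderivP i)),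
    continuousAt_pi.2 fun i => hsymm.continuousAt.comp <|
      (continuousAt_pi.1 hl i).prodMk ((hderivQ i).neg.prodMk continuousAt_const), ?_⟩
  filter_upwards [hE, hdiffQ, hdiffP] with h hE hdiffQ hdiffP
  exact hE.extend hc hC hx₀ hy₀ (fun i => (hdiffQ i).differentiableAt one_ne_zero)
    (fun i => (hdiffP i).differentiableAt one_ne_zero) t

end PRK

theorem IsHamiltonianSolution.exists_extend {d : ℕ} {H₁ H₂ : EuclideanSpace ℝ (Fin d) × ℝ → ℝ}
    {t₀ : ℝ} {q₀ p₀ : EuclideanSpace ℝ (Fin d)} (hH₁ : ContDiffAt ℝ 1 H₁ (q₀, t₀))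
    (hH₂ : ContDiffAt ℝ 1 H₂ (p₀, t₀)) {q p : ℝ → EuclideanSpace ℝ (Fin d)}
    (hqp : IsHamiltonianSolution (separableHamiltonian H₁ H₂) t₀ q₀ p₀ q p) :
    ∃ ξ η : ℝ → ℝ, IsHamiltonianSolution (extendedHamiltonian H₁ H₂) t₀
      ((splitCoords d).symm (q₀, t₀, 0)) ((splitCoords d).symm (p₀, 0, t₀))
      (fun t => (splitCoords d).symm (q t, t, ξ t))
      (fun t => (splitCoords d).symm (p t, η t, t)) := by
  obtain ⟨rfl, rfl, hE⟩ := hqp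
  have hcontq : ∀ᶠ t in 𝓝 t₀, ContinuousAt (fun t => (q t, t)) t :=
    hE.mono fun t ht => ht.1.continuousAt.prodMk continuousAt_id
  have hcontp : ∀ᶠ t in 𝓝 t₀, ContinuousAt (fun t => (p t, t)) t :=
    hE.mono fun t ht => ht.2.continuousAt.prodMk continuousAt_id
  have hdiffq : ∀ᶠ t in 𝓝 t₀, ContDiffAt ℝ 1 H₁ (q t, t) :=
    hcontq.self_of_nhds.eventually (hH₁.eventually (by simp))
  have hdiffp : ∀ᶠ t in 𝓝 t₀, ContDiffAt ℝ 1 H₂ (p t, t) :=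
    hcontp.self_of_nhds.eventually (hH₂.eventually (by simp))
  have hξ' : ∀ᶠ t in 𝓝 t₀, ContinuousAt (fun t => timeDeriv H₂ (p t, t)) t :=
    (hcontp.and hdiffp).mono fun t ht =>
      ContinuousAt.comp (f := fun t => (p t, t)) (continuousAt_timeDeriv ht.2) ht.1
  have hη' : ∀ᶠ t in 𝓝 t₀, ContinuousAt (fun t => -timeDeriv H₁ (q t, t)) t :=
    (hcontq.and hdiffq).mono fun t ht =>
      (ContinuousAt.comp (f := fun t => (q t, t)) (continuousAt_timeDeriv ht.2) ht.1).neg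
  obtain ⟨ξ, hξ₀, hξ⟩ := exists_eventually_hasDerivAt_of_eventually_continuousAt hξ'
  obtain ⟨η, hη₀, hη⟩ := exists_eventually_hasDerivAt_of_eventually_continuousAt hη'
  refine ⟨ξ, η, by simp only [hξ₀], by simp only [hη₀], ?_⟩
  filter_upwards [hE, hξ, hη, hdiffq, hdiffp] with t ⟨hq, hp⟩ hξ hη hdiffq hdiffp
  rw [gradP_separableHamiltonian] at hq
  rw [gradQ_separableHamiltonian] at hp
  have hsymm {z : EuclideanSpace ℝ (Fin d) × ℝ × ℝ} := (splitCoords d).symm.hasFDerivAt (x := z)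
  constructor
  · rw [gradP_extendedHamiltonian, momentumTime_symm]
    · exact hsymm.comp_hasDerivAt t (hq.prodMk ((hasDerivAt_id t).prodMk hξ))
    · rw [momentumTime_symm]; exact hdiffp.differentiableAt one_ne_zero
  · rw [neg_gradQ_extendedHamiltonian, positionTime_symm]
    · exact hsymm.comp_hasDerivAt t (hp.prodMk (hη.prodMk (hasDerivAt_id t)))
    · rw [positionTime_symm]; exact hdiffq.differentiableAt one_ne_zero

namespace PRK

theorem HasOrderAt.restrict {s d r : ℕ} {M : PRK s} (hc : ∀ i, M.c i = ∑ j, M.A i j)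
    (hC : ∀ i, M.C i = ∑ j, M.a i j) {H₁ H₂ : EuclideanSpace ℝ (Fin d) × ℝ → ℝ}
    {t₀ : ℝ} {q₀ p₀ : EuclideanSpace ℝ (Fin d)} (hH₁ : ContDiffAt ℝ 1 H₁ (q₀, t₀))
    (hH₂ : ContDiffAt ℝ 1 H₂ (p₀, t₀))
    (hM : M.HasOrderAt r (extendedHamiltonian H₁ H₂) t₀
      ((splitCoords d).symm (q₀, t₀, 0)) ((splitCoords d).symm (p₀, 0, t₀))) :
    M.HasOrderAt r (separableHamiltonian H₁ H₂) t₀ q₀ p₀ := by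
  obtain ⟨⟨K, L, hKL⟩, herror⟩ := hM
  have hx₀ := positionTime_symm q₀ t₀ 0
  have hy₀ := momentumTime_symm p₀ 0 t₀
  refine ⟨⟨_, _, hKL.restrict hc hC hx₀ hy₀ hH₁ hH₂⟩, fun k l hkl q p hqp => ?_⟩
  obtain ⟨ξ, η, hsol⟩ := hqp.exists_extend hH₁ hH₂
  obtain ⟨hq, hp⟩ := herror _ _ (hkl.extend hc hC hx₀ hy₀ hH₁ hH₂ t₀) _ _ hsol
  let space : EuclideanSpace ℝ (Fin (d + 2)) →L[ℝ] EuclideanSpace ℝ (Fin d) :=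
    .fst ℝ _ (ℝ × ℝ) ∘L
      (splitCoords d : EuclideanSpace ℝ (Fin (d + 2)) →L[ℝ] EuclideanSpace ℝ (Fin d) × ℝ × ℝ)
  have hspace (v : EuclideanSpace ℝ (Fin d)) (a b : ℝ) :
      space ((splitCoords d).symm (v, a, b)) = v := by simp [space]
  constructor
  · refine (((space.isBigO_comp _ _).congr_left fun h => ?_).trans hq)
    rw [map_sub, stepQ_eq_weightedStep, map_weightedStep]
    simp only [hspace]
    rfl
  · refine (((space.isBigO_comp _ _).congr_left fun h => ?_).trans hp)
    rw [map_sub, stepP_eq_weightedStep, map_weightedStep]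
    simp only [hspace]
    rfl

end PRK

theorem mainTheorem1_general {s : ℕ} (M : PRK s) (r : ℕ)
    (hc : ∀ i, M.c i = ∑ j, M.A i j) (hC : ∀ i, M.C i = ∑ j, M.a i j)
    (hM : M.HasOrderAutonomous r) : M.HasOrderNonautonomous r := by
  intro d U V H₁ H₂ hU hV hH₁ hH₂ t₀ q₀ p₀ hq₀ hp₀
  have hH₁' := (hH₁.contDiffAt (hU.mem_nhds hq₀)).of_le (m := 1) (by simp)
  have hH₂' := (hH₂.contDiffAt (hV.mem_nhds hp₀)).of_le (m := 1) (by simp)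
  refine PRK.HasOrderAt.restrict hc hC hH₁' hH₂' ?_
  exact hM (d + 2) (positionTime d ⁻¹' U) (momentumTime d ⁻¹' V) _ _
    (hU.preimage (positionTime d).continuous) (hV.preimage (momentumTime d).continuous)
    (contDiffOn_extendedPotential hH₁) (contDiffOn_extendedKinetic hH₂) t₀
    _ (by rwa [Set.mem_preimage, positionTime_symm])
    _ (by rwa [Set.mem_preimage, momentumTime_symm])

theorem mainTheorem1 {s : ℕ} (M : PRK s) (r : ℕ) (hr : r ≤ 4)
    (hc : ∀ i, M.c i = ∑ j, M.A i j) (hC : ∀ i, M.C i = ∑ j, M.a i j)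
    (hM : M.HasOrderAutonomous r) : M.HasOrderNonautonomous r :=
  mainTheorem1_general M r hc hC hM
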